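/- Let $R$ be a finite commutative principal ideal ring and let $S$ be a Galois extension of $R$ of degree $m\ge 1$ with Galois group generated by $\sigma$, in the following sense: up to isomorphism $R=R_{(1)}\times\cdots\times R_{(\rho)}$ with finite chain rings (finite local principal ideal rings) $R_{(j)}$, $S=S_{(1)}\times\cdots\times S_{(\rho)}$ with $S_{(j)}=R_{(j)}[X]/(h_{(j)})$, where $h_{(j)}\in R_{(j)}[X]$ is monic of degree $m$ and irreducible modulo the maximal ideal of $R_{(j)}$, and $\sigma=(\sigma_{(j)})_{1\le j\le\rho}$ with $\sigma_{(j)}$ a generator of the (cyclic) group of $R_{(j)}$-algebra automorphisms of $S_{(j)}$. For $u=(u_1,\dots,u_n)\in S^n$ let $\mathrm{rk}(u)$ be the smallest number of elements that generate the $R$-submodule of $S$ spanned by $u_1,\dots,u_n$, and let $\sigma^l(u)=(\sigma^l(u_1),\dots,\sigma^l(u_n))$. Let $\mathcal C$ be an $S$-submodule of $S^n$ with generator matrix $G\in S^{k\times n}$, i.e. $\mathcal C$ is generated over $S$ by the rows of $G$. Let $y\in S^n$ and $r\in\mathbb N=\{0,1,2,\dots\}$. The following statements are equivalent. 1. There is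 $c\in\mathcal C$ with $\mathrm{rk}(y-c)\le r$. 2. There are $(z_0,\dots,z_r)\in S^{r+1}$ with $z_r=1$ and $x\in S^k$ such that $$\sum_{l=0}^{r}z_l\,\sigma^l(y)=\sum_{l=0}^{r}z_l\,\sigma^l(xG).$$ Moreover, suppose that $\mathcal C$ is a free $S$-module of rank $k$ and $r\le t$, where $t=\lfloor (d-1)/2\rfloor$ is the error correction capability of $\mathcal C$ and $d=\min\{\mathrm{rk}(c-c') : c,c'\in\mathcal C,\ c\ne c'\}$ (with $t=0$ if $\mathcal C=0$). Then $x$ is unique: if $(z,x)$ and $(z',x')$ both satisfy the conditions in 2, then $x=x'$. -/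

import Mathlib

open Polynomial

universe u v

/-- A presentation of the commutative `R`-algebra `S`, with its automorphism `σ`, as a Galois
extension of degree `m` of the finite principal ideal ring `R`:
* `R ≅ A₁ × ⋯ × A_ρ` with every `A_j` a local principal ideal ring (a chain ring, which is finite
  when `R` is finite);
* `h_j ∈ A_j[X]` is monic of degree `m` and irreducible over the residue field of `A_j`;
* `τ_j` generates the Galois group `Aut_{A_j} (A_j[X] / (h_j))`;
* `S ≅ ∏ A_j[X] / (h_j)`, compatibly with `R ≅ ∏ A_j`, and `σ` corresponds to `(τ_j)_j`. -/
structure GaloisPresentation (R : Type u) (S : Type v) [CommRing R] [CommRing S] [Algebra R S]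
    (m : ℕ) (σ : S ≃ₐ[R] S) where
  m_pos : 0 < m
  /-- number of local components -/
  ρ : ℕ
  /-- local components of `R` -/
  A : Fin ρ → Type u
  [commRing : ∀ j, CommRing (A j)]
  [isLocalRing : ∀ j, IsLocalRing (A j)]
  [isPrincipalIdealRing : ∀ j, IsPrincipalIdealRing (A j)]
  /-- the decomposition of `R` -/
  decompR : R ≃+* (∀ j, A j)
  /-- the defining polynomials -/
  h : ∀ j, (A j)[X]
  monic : ∀ j, (h j).Monic
  natDegree_eq : ∀ j, (h j).natDegree = m
  irreducible : ∀ j, Irreducible ((h j).map (IsLocalRing.residue (A j)))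
  /-- generators of the local Galois groups -/
  τ : ∀ j, AdjoinRoot (h j) ≃ₐ[A j] AdjoinRoot (h j)
  generates : ∀ j, Subgroup.zpowers (τ j) = ⊤
  /-- the decomposition of `S` -/
  decompS : S ≃+* (∀ j, AdjoinRoot (h j))
  decompS_algebraMap : ∀ a j, decompS (algebraMap R S a) j = AdjoinRoot.of (h j) (decompR a j)
  decompS_apply_σ : ∀ s j, decompS (σ s) j = τ j (decompS s j)

/-- `S` is a Galois extension of `R` of degree `m` with Galois group generated by `σ`. -/
def IsGaloisExtension (R : Type u) (S : Type v) [CommRing R] [CommRing S] [Algebra R S]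
    (m : ℕ) (σ : S ≃ₐ[R] S) : Prop :=
  Nonempty (GaloisPresentation R S m σ)

section RankMetric

variable (R : Type u) {S : Type v} [CommRing R] [CommRing S] [Algebra R S] {n : ℕ}

/-- The support of `u ∈ Sⁿ`: the `R`-submodule of `S` generated by the entries of `u`. -/
def rankSupport (u : Fin n → S) : Submodule R S :=
  Submodule.span R (Set.range u)

/-- The rank of `u ∈ Sⁿ`: the least number of elements generating its support over `R`. -/
noncomputable def vectorRank (u : Fin n → S) : ℕ :=
  (rankSupport R u).spanFinrank

/-- The minimum rank distance of a code `C ⊆ Sⁿ` (with value `0` for the zero code). -/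
noncomputable def minRankDistance (C : Submodule S (Fin n → S)) : ℕ :=
  sInf {d | ∃ c ∈ C, ∃ c' ∈ C, c ≠ c' ∧ vectorRank R (c - c') = d}

/-- The error correction capability `⌊(d - 1) / 2⌋` of a code of minimum rank distance `d`
(with value `0` for the zero code). -/
noncomputable def errorCorrectionCapability (C : Submodule S (Fin n → S)) : ℕ :=
  (minRankDistance R C - 1) / 2

end RankMetric

/-- `G` is a generator matrix of the code `C`: its rows generate `C` as an `S`-module. -/
def IsGeneratorMatrix {S : Type v} [CommRing S] {k n : ℕ} (G : Matrix (Fin k) (Fin n) S)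
    (C : Submodule S (Fin n → S)) : Prop :=
  Submodule.span S (Set.range G.row) = C

/-- `σ^l (u)`: the `l`-th power of `σ` applied to every entry of `u`. -/
def powApply {R : Type u} {S : Type v} [CommRing R] [CommRing S] [Algebra R S] {n : ℕ}
    (σ : S ≃ₐ[R] S) (l : ℕ) (u : Fin n → S) : Fin n → S :=
  fun i => (σ ^ l) (u i)

/-- `(z, x)` solves the key equation `∑ z_l σ^l (y) = ∑ z_l σ^l (x G)` with `z_r = 1`. -/
def SolvesKeyEquation {R : Type u} {S : Type v} [CommRing R] [CommRing S] [Algebra R S]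
    {k n r : ℕ} (σ : S ≃ₐ[R] S) (G : Matrix (Fin k) (Fin n) S) (y : Fin n → S)
    (z : Fin (r + 1) → S) (x : Fin k → S) : Prop :=
  z (Fin.last r) = 1 ∧
    ∑ l : Fin (r + 1), z l • powApply σ l y =
      ∑ l : Fin (r + 1), z l • powApply σ l (Matrix.vecMul x G)

/-! Since every `σ^l` is additive, the key equation says that a monic skew polynomial of degree `r`
in `σ` annihilates the entries of the error `e = y - xG`. This is equivalent to `e` having rank at
most `r` (`HasSkewFactorization.vectorRank_le_iff`). If `r` elements generate the support, left
factors `X - c` kill them one after another. Conversely, right division by a suitable `X - c`, whose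
kernel is a cyclic `R`-module, lowers the degree by one at the cost of one generator
(`HasSkewFactorization.generatedBy`).

The arithmetic this needs is collected in `HasSkewFactorization` and checked on local components.
There every element is a power of the uniformizer times a unit, and a lift of Frobenius, which is a
power of the given generator, fixes only the base ring.

Uniqueness of `x` combines the triangle inequality for the rank with injectivity of `x ↦ xG` on a
free code. -/

/-- `N` is generated by a family of `r` elements. -/
def GeneratedBy {R M : Type*} [CommRing R] [AddCommGroup M] [Module R M] (r : ℕ)
    (N : Submodule R M) : Prop :=
  ∃ b : Fin r → M, Submodule.span R (Set.range b) = N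

/-! ### Numbers of generators over a principal ideal ring. -/

namespace GeneratedBy

variable {R M M' : Type*} [CommRing R] [AddCommGroup M] [Module R M] [AddCommGroup M'] [Module R M']

lemma spanFinrank_le {r : ℕ} {N : Submodule R M} (h : GeneratedBy r N) : N.spanFinrank ≤ r := by
  obtain ⟨b, rfl⟩ := h
  refine (Submodule.spanFinrank_span_le_ncard_of_finite (Set.finite_range b)).trans ?_
  have h := Set.ncard_image_le (f := b) (s := Set.univ) Set.finite_univ
  simpa [Set.ncard_univ] using h

lemma cons {r : ℕ} {N : Submodule R M} (h : GeneratedBy r N) (a : M) :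
    GeneratedBy (r + 1) (Submodule.span R {a} ⊔ N) := by
  obtain ⟨b, rfl⟩ := h
  exact ⟨Fin.cons a b, by rw [Fin.range_cons, Submodule.span_insert]⟩

lemma mono {r s : ℕ} (hrs : r ≤ s) {N : Submodule R M} (h : GeneratedBy r N) :
    GeneratedBy s N := by
  induction s, hrs using Nat.le_induction with
  | base => exact h
  | succ s _ ih => simpa using ih.cons 0

lemma of_spanFinrank_le {r : ℕ} {N : Submodule R M} (hN : N.FG) (h : N.spanFinrank ≤ r) :
    GeneratedBy r N := by
  obtain ⟨s, hs, hsN⟩ := hN.exists_span_finset_card_eq_spanFinrank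
  refine mono (hs.trans_le h) ⟨fun i => (s.equivFin.symm i : M), ?_⟩
  rw [← hsN]
  congr 1
  rw [Set.range_comp' Subtype.val, s.equivFin.symm.surjective.range_eq]
  simp

lemma sup {r s : ℕ} {N N' : Submodule R M} (h : GeneratedBy r N) (h' : GeneratedBy s N') :
    GeneratedBy (r + s) (N ⊔ N') := by
  induction r generalizing N with
  | zero =>
    obtain ⟨b, rfl⟩ := h
    simpa using h'
  | succ r ih =>
    obtain ⟨b, rfl⟩ := h
    rw [← Fin.cons_self_tail b, Fin.range_cons, Submodule.span_insert, sup_assoc]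
    have := (ih ⟨Fin.tail b, rfl⟩).cons (b 0)
    rwa [show r + 1 + s = r + s + 1 by omega]

/-- An extension of a module with `r` generators by a cyclic module has `r + 1` generators. -/
lemma of_map_of_ker {r : ℕ} (f : M →ₗ[R] M') {N : Submodule R M} (h : GeneratedBy r (N.map f))
    {a : M} (ha : N ⊓ LinearMap.ker f = Submodule.span R {a}) : GeneratedBy (r + 1) N := by
  obtain ⟨b, hb⟩ := h
  have hmem (i) : ∃ x ∈ N, f x = b i := by
    have : b i ∈ N.map f := hb ▸ Submodule.subset_span ⟨i, rfl⟩
    simpa using this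
  choose c hcN hc using hmem
  have hcb : (Submodule.span R (Set.range c)).map f = N.map f := by
    rw [Submodule.map_span, ← Set.range_comp, ← hb]
    congr 2
    exact funext hc
  have hcle : Submodule.span R (Set.range c) ≤ N := by
    rw [Submodule.span_le]
    rintro _ ⟨i, rfl⟩
    exact hcN i
  have hN : Submodule.span R {a} ⊔ Submodule.span R (Set.range c) = N := by
    rw [← ha]
    refine le_antisymm (sup_le inf_le_left hcle) fun x hx => ?_
    have : f x ∈ (Submodule.span R (Set.range c)).map f := hcb ▸ Submodule.mem_map_of_mem hx
    obtain ⟨w, hw, hwx⟩ := this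
    rw [← sub_add_cancel x w]
    exact Submodule.add_mem_sup ⟨N.sub_mem hx (hcle hw), by simp [hwx]⟩ hw
  rw [← hN]
  exact cons ⟨c, rfl⟩ a

/-- A submodule of a cyclic module over a principal ideal ring is cyclic. -/
lemma exists_span_singleton_of_le [IsPrincipalIdealRing R] {N : Submodule R M} {a : M}
    (h : N ≤ Submodule.span R {a}) : ∃ b, N = Submodule.span R {b} := by
  obtain ⟨g, hg⟩ := IsPrincipalIdealRing.principal (N.comap (LinearMap.toSpanSingleton R M a))
  refine ⟨g • a, ?_⟩
  have hmap := Submodule.map_comap_eq_of_le (f := LinearMap.toSpanSingleton R M a) (p := N)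
    (by rwa [LinearMap.range_toSpanSingleton])
  rw [← hmap, hg, Submodule.map_span]
  simp

/-- Over a principal ideal ring, submodules do not need more generators. -/
lemma of_le [IsPrincipalIdealRing R] {r : ℕ} {N N' : Submodule R M} (h : GeneratedBy r N')
    (hle : N ≤ N') : GeneratedBy r N := by
  induction r generalizing M with
  | zero =>
    obtain ⟨b, rfl⟩ := h
    exact ⟨b, by symm; simpa using hle⟩
  | succ r ih =>
    obtain ⟨b, rfl⟩ := h
    -- Induction passes to the quotient by the first generator; the part of `N` lost there is
    -- cyclic.
    have hker : N ⊓ LinearMap.ker (Submodule.span R {b 0}).mkQ ≤ Submodule.span R {b 0} := by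
      simp
    obtain ⟨a, ha⟩ := exists_span_singleton_of_le hker
    refine of_map_of_ker _ (ih (N' := (Submodule.span R (Set.range b)).map
      (Submodule.span R {b 0}).mkQ) ?_ (Submodule.map_mono hle)) ha
    refine ⟨(Submodule.span R {b 0}).mkQ ∘ Fin.tail b, ?_⟩
    rw [Set.range_comp, ← Submodule.map_span]
    have hb : Set.range b = insert (b 0) (Set.range (Fin.tail b)) := by
      rw [← Fin.range_cons, Fin.cons_self_tail]
    rw [hb, Submodule.span_insert, Submodule.map_sup, Submodule.mkQ_map_self, bot_sup_eq]

end GeneratedBy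

/-! ### Skew polynomials and their kernels. -/

section Skew

variable {R : Type u} {S : Type v} [CommRing R] [CommRing S] [Algebra R S] (σ : S ≃ₐ[R] S)

/-- Evaluation of the skew polynomial `∑_{l < r} z_l X^l` at `σ`. -/
def skewEval (z : ℕ → S) (r : ℕ) : S →ₗ[R] S :=
  ∑ l ∈ Finset.range r, LinearMap.mulLeft R (z l) ∘ₗ (σ ^ l).toLinearMap

lemma skewEval_apply (z : ℕ → S) (r : ℕ) (s : S) :
    skewEval σ z r s = ∑ l ∈ Finset.range r, z l * (σ ^ l) s := by
  simp [skewEval]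

lemma skewEval_succ (z : ℕ → S) (r : ℕ) (s : S) :
    skewEval σ z (r + 1) s = skewEval σ z r s + z r * (σ ^ r) s := by
  simp [skewEval_apply, Finset.sum_range_succ]

lemma skewEval_congr {z w : ℕ → S} {r : ℕ} (h : ∀ l < r, z l = w l) (s : S) :
    skewEval σ z r s = skewEval σ w r s := by
  simp only [skewEval_apply]
  exact Finset.sum_congr rfl fun l hl => by rw [h l (Finset.mem_range.1 hl)]

/-- Right division of a skew polynomial by `X - c`. -/
lemma exists_skewEval_divide (c : S) (r : ℕ) (z : ℕ → S) :
    ∃ (w : ℕ → S) (ρ : S), w r = z (r + 1) ∧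
      ∀ s, skewEval σ z (r + 2) s = skewEval σ w (r + 1) (σ s - c * s) + ρ * s := by
  induction r generalizing z with
  | zero =>
    refine ⟨fun _ => z 1, z 0 + z 1 * c, rfl, fun s => ?_⟩
    simp [skewEval_apply, Finset.sum_range_succ]
    ring
  | succ r ih =>
    -- `X^(r+2) = X^(r+1) (X - c) + σ^(r+1)(c) X^(r+1)`: the last term is absorbed into the
    -- coefficient of `X^(r+1)` before dividing further.
    obtain ⟨w, ρ, -, h⟩ :=
      ih (Function.update z (r + 1) (z (r + 1) + z (r + 2) * (σ ^ (r + 1)) c))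
    refine ⟨Function.update w (r + 1) (z (r + 2)), ρ, by simp, fun s => ?_⟩
    have h1 := h s
    rw [skewEval_succ, skewEval_congr σ (w := z) (fun l hl => by simp [hl.ne])] at h1
    rw [skewEval_succ, skewEval_succ, skewEval_succ _ _ (r + 1),
      skewEval_congr σ (z := Function.update w _ _) (w := w) (fun l hl => by simp [hl.ne])]
    simp only [Function.update_self] at h1 ⊢
    have h2 : (σ ^ (r + 2)) s = (σ ^ (r + 1)) (σ s) := by rw [pow_succ]; rfl
    have h3 : (σ ^ (r + 1)) (σ s - c * s) =
        (σ ^ (r + 1)) (σ s) - (σ ^ (r + 1)) c * (σ ^ (r + 1)) s := by rw [map_sub, map_mul]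
    rw [h2, h3]
    linear_combination h1

/-- Left multiplication of a skew polynomial by `X - c`. -/
lemma exists_skewEval_mul (c : S) (r : ℕ) (z : ℕ → S) (hz : z r = 1) :
    ∃ w : ℕ → S, w (r + 1) = 1 ∧
      ∀ s, skewEval σ w (r + 2) s = σ (skewEval σ z (r + 1) s) - c * skewEval σ z (r + 1) s := by
  -- As `X z = σ(z) X`, the product has coefficients `σ(z_{l-1}) - c z_l`. The second conditional
  -- discards `z_{r+1}`, which is arbitrary.
  refine ⟨fun l => (if l = 0 then 0 else σ (z (l - 1))) - if l = r + 1 then 0 else c * z l,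
    by simp [hz], fun s => ?_⟩
  simp only [skewEval_apply, sub_mul, Finset.sum_sub_distrib]
  congr 1
  · rw [Finset.sum_range_succ']
    simp only [Nat.add_eq_zero_iff, one_ne_zero, and_false, if_false, if_true, zero_mul, add_zero,
      Nat.add_sub_cancel, map_sum, map_mul]
    exact Finset.sum_congr rfl fun l _ => by rw [pow_succ']; rfl
  · rw [Finset.sum_range_succ, Finset.mul_sum]
    simp only [if_true, zero_mul, add_zero]
    refine Finset.sum_congr rfl fun l hl => ?_
    rw [if_neg (Finset.mem_range.1 hl).ne, mul_assoc]

variable {σ}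

/-- Any `r` elements are annihilated by a monic skew polynomial of degree `r`. -/
lemma exists_skewEval_eq_zero (hdvd : ∀ s : S, ∃ c, σ s = c * s) {r : ℕ} (b : Fin r → S) :
    ∃ z : ℕ → S, z r = 1 ∧ ∀ i, skewEval σ z (r + 1) (b i) = 0 := by
  induction r with
  | zero => exact ⟨fun _ => 1, rfl, fun i => i.elim0⟩
  | succ r ih =>
    obtain ⟨z, hz, h⟩ := ih (Fin.init b)
    obtain ⟨c, hc⟩ := hdvd (skewEval σ z (r + 1) (b (Fin.last r)))
    obtain ⟨w, hw, h'⟩ := exists_skewEval_mul σ c r z hz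
    refine ⟨w, hw, fun i => ?_⟩
    rw [h']
    refine Fin.lastCases ?_ (fun j => ?_) i
    · rw [hc, sub_self]
    · have := h j
      simp only [Fin.init] at this
      rw [this, map_zero, mul_zero, sub_zero]

/-- The properties of a Galois extension of a principal ideal ring which bound the rank of the
kernels of skew polynomials. -/
structure HasSkewFactorization (σ : S ≃ₐ[R] S) : Prop where
  exists_unit : ∀ b : S, ∃ (a : R) (u : Sˣ), b = algebraMap R S a * u
  exists_dvd : ∀ N : Submodule R S, ∃ b ∈ N, ∀ s ∈ N, b ∣ s
  mem_range : ∀ s : S, σ s = s → s ∈ Set.range (algebraMap R S)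

/-- Write `s = a u` with `u` a unit: `σ` fixes `a`, so `c = σ(u) / u` works even when `s` is a zero
divisor. -/
lemma HasSkewFactorization.exists_mul (h : HasSkewFactorization σ) (s : S) : ∃ c, σ s = c * s := by
  obtain ⟨a, u, rfl⟩ := h.exists_unit s
  refine ⟨σ u * ↑u⁻¹, ?_⟩
  rw [map_mul, σ.commutes]
  linear_combination (-(σ u * algebraMap R S a)) * u.inv_mul

/-- A submodule annihilated by a monic skew polynomial of degree `r` has `r` generators. -/
lemma HasSkewFactorization.generatedBy [IsPrincipalIdealRing R] (h : HasSkewFactorization σ)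
    {r : ℕ} {z : ℕ → S} (hz : z r = 1) {N : Submodule R S}
    (hN : ∀ s ∈ N, skewEval σ z (r + 1) s = 0) : GeneratedBy r N := by
  induction r generalizing z N with
  | zero =>
    refine ⟨Fin.elim0, ?_⟩
    simp only [Set.range_eq_empty, Submodule.span_empty]
    symm
    rw [Submodule.eq_bot_iff]
    intro s hs
    simpa [skewEval_apply, hz] using hN s hs
  | succ r ih =>
    obtain ⟨b, hb, hbN⟩ := h.exists_dvd N
    obtain ⟨a, u, hu⟩ := h.exists_unit b
    -- Built from the unit `u` rather than from `b`, so that `X - c` kills `b` and its kernel is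
    -- exactly `R u`.
    set c : S := σ u * ↑u⁻¹ with hc
    have hcu : c * u = σ u := by rw [hc, mul_assoc, u.inv_mul, mul_one]
    have hcb : σ b = c * b := by
      rw [hu, map_mul, σ.commutes, ← hcu]
      ring
    obtain ⟨w, ρ, hw, hdiv⟩ := exists_skewEval_divide σ c r z
    have hρb : ρ * b = 0 := by
      have := hdiv b
      rwa [hN b hb, hcb, sub_self, map_zero, zero_add, eq_comm] at this
    -- The remainder `ρ` need not vanish, but it kills `b` and hence every multiple of `b`, in
    -- particular `N`.
    have hρ (s) (hs : s ∈ N) : ρ * s = 0 := by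
      obtain ⟨t, rfl⟩ := hbN s hs
      rw [← mul_assoc, hρb, zero_mul]
    let L : S →ₗ[R] S := σ.toLinearMap - LinearMap.mulLeft R c
    have hL (s) : L s = σ s - c * s := rfl
    have hmap : GeneratedBy r (N.map L) := by
      refine ih (hw.trans hz) ?_
      rintro _ ⟨s, hs, rfl⟩
      rw [hL]
      have := hdiv s
      rwa [hN s hs, hρ s hs, add_zero, eq_comm] at this
    have hker : N ⊓ LinearMap.ker L ≤ Submodule.span R {(u : S)} := by
      rintro s ⟨-, hs⟩
      have hs : σ s = c * s := sub_eq_zero.1 hs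
      obtain ⟨a', ha'⟩ := h.mem_range (s * ↑u⁻¹) (by
        have hui : σ u * σ ↑u⁻¹ = 1 := by rw [← map_mul, u.mul_inv, map_one]
        rw [map_mul, hs, hc]
        linear_combination (s * ↑u⁻¹) * hui)
      refine Submodule.mem_span_singleton.2 ⟨a', ?_⟩
      rw [Algebra.smul_def, ha', mul_assoc, u.inv_mul, mul_one]
    obtain ⟨x, hx⟩ := GeneratedBy.exists_span_singleton_of_le hker
    exact GeneratedBy.of_map_of_ker L hmap hx

end Skew

/-! ### Local extensions: unit factorization and fixed points of Frobenius. -/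

/-- The `q` elements of `K` already exhaust the roots of `X^q - X`. -/
lemma FiniteField.mem_range_algebraMap_of_pow_card_eq_self {K L : Type*} [Field K] [Fintype K]
    [Field L] [Algebra K L] {x : L} (hx : x ^ Fintype.card K = x) :
    x ∈ Set.range (algebraMap K L) := by
  classical
  have hq := Fintype.one_lt_card (α := K)
  have h0 : (X ^ Fintype.card K - X : L[X]) ≠ 0 := FiniteField.X_pow_card_sub_X_ne_zero L hq
  have hsub : Finset.univ.image (algebraMap K L) ⊆
      (X ^ Fintype.card K - X : L[X]).roots.toFinset := by
    intro y hy
    obtain ⟨a, -, rfl⟩ := Finset.mem_image.1 hy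
    simp [h0, ← map_pow, FiniteField.pow_card]
  have heq := Finset.eq_of_subset_of_card_le hsub (by
    rw [Finset.card_image_of_injective _ (algebraMap K L).injective, Finset.card_univ]
    refine (Multiset.toFinset_card_le _).trans ((card_roots' _).trans_eq ?_)
    exact FiniteField.X_pow_card_sub_X_natDegree_eq L hq)
  have hmem : x ∈ (X ^ Fintype.card K - X : L[X]).roots.toFinset := by
    simp [h0, hx]
  rw [← heq] at hmem
  simpa using hmem

namespace LocalExtension

variable {A : Type u} [CommRing A] [IsLocalRing A] (h : A[X])

open IsLocalRing

/-- Reduction of `A[X] / (h)` modulo the maximal ideal of `A`. -/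
noncomputable def red : AdjoinRoot h →+* AdjoinRoot (h.map (residue A)) :=
  AdjoinRoot.lift ((AdjoinRoot.of _).comp (residue A)) (AdjoinRoot.root _) (by
    rw [← eval₂_map, AdjoinRoot.eval₂_root])

lemma red_of (a : A) : red h (AdjoinRoot.of h a) = AdjoinRoot.of _ (residue A a) := by
  simp [red]

lemma red_root : red h (AdjoinRoot.root h) = AdjoinRoot.root _ := by
  simp [red]

lemma red_mk (p : A[X]) : red h (AdjoinRoot.mk h p) = AdjoinRoot.mk _ (p.map (residue A)) := by
  rw [red, AdjoinRoot.lift_mk, ← eval₂_map]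
  exact AdjoinRoot.aeval_eq _

lemma red_surjective : Function.Surjective (red h) := by
  intro x
  obtain ⟨q, rfl⟩ := AdjoinRoot.mk_surjective x
  obtain ⟨p, rfl⟩ := map_surjective (residue A) residue_surjective q
  exact ⟨AdjoinRoot.mk h p, red_mk h p⟩

variable {h}

lemma dvd_of_red_eq_zero {π : A} (hπ : maximalIdeal A = Ideal.span {π}) {s : AdjoinRoot h}
    (hs : red h s = 0) : AdjoinRoot.of h π ∣ s := by
  obtain ⟨p, rfl⟩ := AdjoinRoot.mk_surjective s
  rw [red_mk, AdjoinRoot.mk_eq_zero] at hs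
  obtain ⟨q', hq⟩ := hs
  obtain ⟨q, rfl⟩ := map_surjective (residue A) residue_surjective q'
  have hd : C π ∣ p - h * q := by
    rw [C_dvd_iff_dvd_coeff]
    intro i
    rw [← Ideal.mem_span_singleton, ← hπ, ← residue_eq_zero_iff, ← coeff_map]
    simp [hq]
  have := map_dvd (AdjoinRoot.mk h) hd
  simpa using this

lemma red_of_self {π : A} (hπ : maximalIdeal A = Ideal.span {π}) :
    red h (AdjoinRoot.of h π) = 0 := by
  have : residue A π = 0 := by
    rw [residue_eq_zero_iff, hπ]
    exact Ideal.mem_span_singleton_self π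
  rw [red_of, this, map_zero]

lemma isNilpotent_of_red_eq_zero {π : A} (hπ : maximalIdeal A = Ideal.span {π})
    (hnil : IsNilpotent π) {s : AdjoinRoot h} (hs : red h s = 0) : IsNilpotent s := by
  obtain ⟨t, rfl⟩ := dvd_of_red_eq_zero hπ hs
  exact (Commute.all _ _).isNilpotent_mul_right (hnil.map _)

variable (hirr : Irreducible (h.map (residue A)))
include hirr

lemma isUnit_of_red_ne_zero {π : A} (hπ : maximalIdeal A = Ideal.span {π})
    (hnil : IsNilpotent π) {s : AdjoinRoot h} (hs : red h s ≠ 0) : IsUnit s := by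
  have := Fact.mk hirr
  obtain ⟨t, ht⟩ := red_surjective h (red h s)⁻¹
  have h1 : red h (s * t - 1) = 0 := by
    rw [map_sub, map_mul, ht, mul_inv_cancel₀ hs, map_one, sub_self]
  have h2 := (isNilpotent_of_red_eq_zero hπ hnil h1).isUnit_add_one
  rw [sub_add_cancel] at h2
  exact isUnit_of_mul_isUnit_left h2

/-- Factors `π` are split off until the cofactor is nonzero in the residue field; if this goes on
past the nilpotency index, then `s = 0 = π^ν * 1`. -/
lemma exists_eq_pow_mul_unit {π : A} (hπ : maximalIdeal A = Ideal.span {π})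
    (hnil : IsNilpotent π) (s : AdjoinRoot h) :
    ∃ (k : ℕ) (w : (AdjoinRoot h)ˣ), s = AdjoinRoot.of h π ^ k * w := by
  have key (j : ℕ) (s : AdjoinRoot h) :
      (∃ (k : ℕ) (w : (AdjoinRoot h)ˣ), s = AdjoinRoot.of h π ^ k * w) ∨
        AdjoinRoot.of h π ^ j ∣ s := by
    induction j generalizing s with
    | zero => simp
    | succ j ih =>
      by_cases hs : red h s = 0
      · obtain ⟨t, rfl⟩ := dvd_of_red_eq_zero hπ hs
        rcases ih t with ⟨k, w, rfl⟩ | ht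
        · exact Or.inl ⟨k + 1, w, by ring⟩
        · exact Or.inr (by rw [pow_succ']; exact mul_dvd_mul_left _ ht)
      · obtain ⟨w, rfl⟩ := isUnit_of_red_ne_zero hirr hπ hnil hs
        exact Or.inl ⟨0, w, by simp⟩
  obtain ⟨ν, hν⟩ := hnil
  rcases key ν s with hs | hs
  · exact hs
  · rw [← map_pow, hν, map_zero, zero_dvd_iff] at hs
    exact ⟨ν, 1, by rw [hs, ← map_pow, hν]; simp⟩

lemma exists_dvd {π : A} (hπ : maximalIdeal A = Ideal.span {π}) (hnil : IsNilpotent π)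
    {N : Set (AdjoinRoot h)} (hN : N.Nonempty) : ∃ b ∈ N, ∀ s ∈ N, b ∣ s := by
  classical
  have hex : ∃ k, ∃ w : (AdjoinRoot h)ˣ, AdjoinRoot.of h π ^ k * w ∈ N := by
    obtain ⟨s, hs⟩ := hN
    obtain ⟨k, w, rfl⟩ := exists_eq_pow_mul_unit hirr hπ hnil s
    exact ⟨k, w, hs⟩
  obtain ⟨w, hw⟩ := Nat.find_spec hex
  refine ⟨_, hw, fun s hs => ?_⟩
  obtain ⟨k, w', rfl⟩ := exists_eq_pow_mul_unit hirr hπ hnil s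
  rw [Units.mul_right_dvd, Units.dvd_mul_right]
  exact pow_dvd_pow _ (Nat.find_min' hex ⟨w', hs⟩)

/-- The Frobenius automorphism of the residue field extension lifts to `A[X] / (h)`. -/
lemma exists_frobenius_lift [Finite A] (hmon : h.Monic) {π : A}
    (hπ : maximalIdeal A = Ideal.span {π}) (hnil : IsNilpotent π) :
    ∃ φ : AdjoinRoot h ≃ₐ[A] AdjoinRoot h,
      ∀ s, red h (φ s) = red h s ^ Nat.card (ResidueField A) := by
  have := Fact.mk hirr
  have : Finite (ResidueField A) := Finite.of_surjective _ residue_surjective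
  let _ := Fintype.ofFinite (ResidueField A)
  rw [Nat.card_eq_fintype_card]
  set F := AdjoinRoot (h.map (residue A))
  let Frob : F →ₐ[ResidueField A] F := FiniteField.frobeniusAlgHom (ResidueField A) F
  have hFrob (x : F) : Frob x = x ^ Fintype.card (ResidueField A) := rfl
  set α := AdjoinRoot.root h
  -- An approximate root of `h`: `h(x)` is nilpotent and `h'(x)` is a unit by separability, so
  -- Newton iteration corrects `x` to a true root `β`.
  set x := α ^ Fintype.card (ResidueField A)
  have hred (p : A[X]) : red h (aeval x p) = Frob (red h (AdjoinRoot.mk h p)) := by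
    have hx : red h x = Frob (AdjoinRoot.root _) := by rw [hFrob, map_pow, red_root]
    rw [red_mk, aeval_def, hom_eval₂, hx]
    have h1 : (red h).comp (algebraMap A (AdjoinRoot h)) =
        (algebraMap (ResidueField A) F).comp (residue A) := by
      ext a
      exact red_of h a
    rw [h1, ← eval₂_map, ← aeval_def, aeval_algHom_apply, AdjoinRoot.aeval_eq]
  have hroot : IsNilpotent (aeval x h) := by
    apply isNilpotent_of_red_eq_zero hπ hnil
    rw [hred, AdjoinRoot.mk_self, map_zero, map_zero]
  have hsep : IsUnit (aeval x (derivative h)) := by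
    apply isUnit_of_red_ne_zero hirr hπ hnil
    rw [hred, _root_.map_ne_zero, red_mk, ← derivative_map, Ne,
      AdjoinRoot.mk_eq_zero]
    intro hd
    exact (PerfectField.separable_of_irreducible hirr).isUnit_of_dvd' dvd_rfl hd |>
      hirr.not_isUnit
  obtain ⟨β, ⟨hβ, hβ0⟩, -⟩ :=
    existsUnique_nilpotent_sub_and_aeval_eq_zero hroot hsep
  let φ : AdjoinRoot h →ₐ[A] AdjoinRoot h :=
    AdjoinRoot.liftAlgHom h (Algebra.ofId A _) β (by rw [← hβ0]; rfl)
  have hφ : (red h).comp φ.toRingHom = Frob.toRingHom.comp (red h) := by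
    apply AdjoinRoot.ringHom_ext
    · ext a
      have h1 : φ (AdjoinRoot.of h a) = AdjoinRoot.of h a := φ.commutes a
      have h2 : Frob (AdjoinRoot.of _ (residue A a)) = AdjoinRoot.of _ (residue A a) :=
        Frob.commutes _
      change red h (φ (AdjoinRoot.of h a)) = Frob (red h (AdjoinRoot.of h a))
      rw [h1, red_of, h2]
    · have h1 : φ α = β := AdjoinRoot.liftAlgHom_root ..
      change red h (φ α) = Frob (red h α)
      rw [h1, hFrob, ← map_pow]
      have := (hβ.map (red h)).eq_zero
      rw [map_sub, sub_eq_zero] at this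
      exact this.symm
  have hφ' (s) : red h (φ s) = red h s ^ Fintype.card (ResidueField A) :=
    congr($hφ s)
  have : Module.Finite A (AdjoinRoot h) := hmon.finite_adjoinRoot
  have : Finite (AdjoinRoot h) := Module.finite_of_finite A
  -- `φ` fixes `π` and preserves units, so it kills `π^k w` only if `π^k = 0`.
  have hinj : Function.Injective φ := by
    rw [injective_iff_map_eq_zero]
    intro s hs
    obtain ⟨k, w, rfl⟩ := exists_eq_pow_mul_unit hirr hπ hnil s
    have h1 : φ (AdjoinRoot.of h π) = AdjoinRoot.of h π := φ.commutes π
    rw [map_mul, map_pow, h1, (w.isUnit.map φ).mul_left_eq_zero] at hs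
    rw [hs, zero_mul]
  exact ⟨AlgEquiv.ofBijective φ (Finite.injective_iff_bijective.1 hinj), hφ'⟩

/-- Successive approximation: the residue of a fixed `s` lies in the residue field of `A`; subtract
a lift, divide by `π` and repeat, until `π^ν = 0`. -/
lemma mem_range_of_frobenius_fixed [Finite A] {π : A}
    (hπ : maximalIdeal A = Ideal.span {π}) (hnil : IsNilpotent π)
    (φ : AdjoinRoot h ≃ₐ[A] AdjoinRoot h)
    (hφ : ∀ s, red h (φ s) = red h s ^ Nat.card (ResidueField A))
    {s : AdjoinRoot h} (hs : φ s = s) : s ∈ Set.range (AdjoinRoot.of h) := by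
  classical
  have := Fact.mk hirr
  have : Finite (ResidueField A) := Finite.of_surjective _ residue_surjective
  let _ := Fintype.ofFinite (ResidueField A)
  set P := AdjoinRoot.of h π
  have hφP : φ P = P := φ.commutes π
  have hP : ∃ ν, P ^ ν = 0 := hnil.map (AdjoinRoot.of h)
  set ν := Nat.find hP with hν
  have hν0 : P ^ ν = 0 := Nat.find_spec hP
  -- `P` is nilpotent, but cancelling it loses only an element killed by `P`, which is a multiple of
  -- `P^(ν-1)`.
  have hcancel (j : ℕ) (hj : j + 1 ≤ ν) (x) (hx : P ^ (j + 1) ∣ P * x) : P ^ j ∣ x := by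
    obtain ⟨t, ht⟩ := hx
    obtain ⟨k, w, hk⟩ := exists_eq_pow_mul_unit hirr hπ hnil (x - P ^ j * t)
    have h0 : P ^ (k + 1) * w = 0 := by
      rw [pow_succ', mul_assoc, ← hk, mul_sub, ht]
      ring
    rw [w.isUnit.mul_left_eq_zero] at h0
    have hle : ν ≤ k + 1 := Nat.find_min' hP h0
    have hd : P ^ j ∣ x - P ^ j * t := by
      rw [hk]
      exact (pow_dvd_pow _ (by omega)).mul_right _
    simpa using dvd_add hd (dvd_mul_right (P ^ j) t)
  have key (j : ℕ) (hj : j ≤ ν) (s : AdjoinRoot h) (hs : P ^ j ∣ φ s - s) :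
      ∃ a, P ^ j ∣ s - AdjoinRoot.of h a := by
    induction j generalizing s with
    | zero => exact ⟨0, by simp⟩
    | succ j ih =>
      have hfix : red h s ^ Nat.card (ResidueField A) = red h s := by
        rw [← hφ, ← sub_eq_zero, ← map_sub]
        obtain ⟨t, ht⟩ := hs
        rw [ht, map_mul, map_pow, red_of_self hπ, zero_pow (by omega), zero_mul]
      obtain ⟨a₀, ha₀⟩ : ∃ a, algebraMap (ResidueField A) _ a = red h s := by
        rw [Nat.card_eq_fintype_card] at hfix
        exact FiniteField.mem_range_algebraMap_of_pow_card_eq_self hfix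
      obtain ⟨a, rfl⟩ := residue_surjective a₀
      have h1 : red h (s - AdjoinRoot.of h a) = 0 := by
        rw [map_sub, red_of, ← ha₀]
        exact sub_self _
      obtain ⟨t, ht⟩ := dvd_of_red_eq_zero hπ h1
      have hst : s = AdjoinRoot.of h a + P * t := by rw [← ht]; ring
      have hφa : φ (AdjoinRoot.of h a) = AdjoinRoot.of h a := φ.commutes a
      have h2 : φ s - s = P * (φ t - t) := by
        rw [hst, map_add, map_mul, hφa, hφP]
        ring
      obtain ⟨b, hb⟩ := ih (by omega) t (hcancel j hj _ (h2 ▸ hs))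
      refine ⟨a + π * b, ?_⟩
      have h3 : s - AdjoinRoot.of h (a + π * b) = P * (t - AdjoinRoot.of h b) := by
        rw [hst, map_add, map_mul]
        ring
      rw [h3, pow_succ']
      exact mul_dvd_mul_left _ hb
  obtain ⟨a, ha⟩ := key ν le_rfl s (by simp [hs])
  rw [hν0, zero_dvd_iff, sub_eq_zero] at ha
  exact ⟨a, ha.symm⟩

/-- The Frobenius lift is a power of `τ`, so it fixes whatever `τ` fixes. -/
lemma mem_range_of_generator_fixed [Finite A] (hmon : h.Monic) {π : A}
    (hπ : maximalIdeal A = Ideal.span {π}) (hnil : IsNilpotent π)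
    {τ : AdjoinRoot h ≃ₐ[A] AdjoinRoot h} (hτ : Subgroup.zpowers τ = ⊤)
    {s : AdjoinRoot h} (hs : τ s = s) : s ∈ Set.range (AdjoinRoot.of h) := by
  obtain ⟨φ, hφ⟩ := exists_frobenius_lift hirr hmon hπ hnil
  refine mem_range_of_frobenius_fixed hirr hπ hnil φ hφ ?_
  have hle : Subgroup.zpowers τ ≤ MulAction.stabilizer (AdjoinRoot h ≃ₐ[A] AdjoinRoot h) s := by
    rw [Subgroup.zpowers_le]
    exact hs
  exact hle (hτ ▸ Subgroup.mem_top φ)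

end LocalExtension

/-! ### From local components to the whole extension. -/

lemma IsLocalRing.exists_maximalIdeal_eq_span_nilpotent (A : Type*) [CommRing A] [IsLocalRing A]
    [IsPrincipalIdealRing A] [Finite A] :
    ∃ π : A, IsLocalRing.maximalIdeal A = Ideal.span {π} ∧ IsNilpotent π := by
  obtain ⟨π, hπ⟩ := IsPrincipalIdealRing.principal (IsLocalRing.maximalIdeal A)
  refine ⟨π, hπ, ?_⟩
  have h := IsArtinianRing.isNilpotent_jacobson_bot (R := A)
  rw [IsLocalRing.jacobson_eq_maximalIdeal _ bot_ne_top] at h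
  obtain ⟨n, hn⟩ := h
  refine ⟨n, ?_⟩
  have : π ^ n ∈ IsLocalRing.maximalIdeal A ^ n :=
    Ideal.pow_mem_pow (hπ ▸ Submodule.mem_span_singleton_self π) n
  simpa [hn] using this

/-- A Galois extension of a finite principal ideal ring has, componentwise, the properties of an
extension of finite chain rings. -/
lemma IsGaloisExtension.hasSkewFactorization {R : Type u} {S : Type v} [CommRing R] [Finite R]
    [CommRing S] [Algebra R S] {m : ℕ} {σ : S ≃ₐ[R] S} (hσ : IsGaloisExtension R S m σ) :
    HasSkewFactorization σ := by
  classical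
  obtain ⟨P⟩ := hσ
  let _ := P.commRing
  have := P.isLocalRing
  have := P.isPrincipalIdealRing
  have hfin (j) : Finite (P.A j) :=
    Finite.of_surjective (fun a => P.decompR a j)
      ((Function.surjective_eval j).comp P.decompR.surjective)
  choose π hπ hnil using fun j => IsLocalRing.exists_maximalIdeal_eq_span_nilpotent (P.A j)
  have hmap (a j) : P.decompS (algebraMap R S (P.decompR.symm a)) j =
      AdjoinRoot.of (P.h j) (a j) := by
    rw [P.decompS_algebraMap, RingEquiv.apply_symm_apply]
  refine ⟨fun b => ?_, fun N => ?_, fun s hs => ?_⟩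
  · choose k w hw using fun j =>
      LocalExtension.exists_eq_pow_mul_unit (P.irreducible j) (hπ j) (hnil j) (P.decompS b j)
    refine ⟨P.decompR.symm fun j => π j ^ k j,
      Units.map P.decompS.symm.toRingHom.toMonoidHom (MulEquiv.piUnits.symm w), ?_⟩
    apply P.decompS.injective
    funext j
    rw [map_mul, Pi.mul_apply, hmap, map_pow, hw]
    congr 1
    change _ = P.decompS (P.decompS.symm _) j
    rw [RingEquiv.apply_symm_apply]
    rfl
  · have hex (j) := LocalExtension.exists_dvd (P.irreducible j) (hπ j) (hnil j)
      (N := (fun s => P.decompS s j) '' (N : Set S)) (Set.Nonempty.image _ ⟨0, N.zero_mem⟩)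
    choose b hb hbN using hex
    choose c hc hcb using hb
    -- The idempotents of `R` glue the componentwise minimal elements `c i` into one element, still
    -- in `N`.
    have hval (j) : P.decompS (∑ i, P.decompR.symm (Pi.single i 1) • c i) j = b j := by
      rw [map_sum, Finset.sum_apply, Finset.sum_eq_single j]
      · rw [Algebra.smul_def, map_mul, Pi.mul_apply, hmap, Pi.single_eq_same, map_one, one_mul]
        exact hcb j
      · intro i _ hij
        rw [Algebra.smul_def, map_mul, Pi.mul_apply, hmap, Pi.single_eq_of_ne hij.symm, map_zero,
          zero_mul]
      · simp
    refine ⟨∑ i, P.decompR.symm (Pi.single i 1) • c i,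
      N.sum_mem fun i _ => N.smul_mem _ (hc i), fun s hs => ?_⟩
    choose t ht using fun j => hbN j _ ⟨s, hs, rfl⟩
    refine ⟨P.decompS.symm t, P.decompS.injective ?_⟩
    funext j
    rw [map_mul, Pi.mul_apply, hval, RingEquiv.apply_symm_apply]
    exact ht j
  · have hfix (j) : P.τ j (P.decompS s j) = P.decompS s j := by
      rw [← P.decompS_apply_σ, hs]
    choose a ha using fun j => LocalExtension.mem_range_of_generator_fixed (P.irreducible j)
      (P.monic j) (hπ j) (hnil j) (P.generates j) (hfix j)
    refine ⟨P.decompR.symm a, P.decompS.injective ?_⟩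
    funext j
    rw [hmap, ha]

/-! ### The rank metric, the key equation and unique decoding. -/

section RankMetric

variable {R : Type u} {S : Type v} [CommRing R] [CommRing S] [Algebra R S] {n : ℕ}

lemma rankSupport_fg (u : Fin n → S) : (rankSupport R u).FG :=
  Submodule.fg_span (Set.finite_range u)

lemma vectorRank_le_iff {u : Fin n → S} {r : ℕ} :
    vectorRank R u ≤ r ↔ GeneratedBy r (rankSupport R u) :=
  ⟨GeneratedBy.of_spanFinrank_le (rankSupport_fg u), GeneratedBy.spanFinrank_le⟩

lemma vectorRank_eq_zero_iff {u : Fin n → S} : vectorRank R u = 0 ↔ u = 0 := by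
  rw [vectorRank, Submodule.spanFinrank_eq_zero_iff_eq_bot (rankSupport_fg u), rankSupport,
    Submodule.span_eq_bot]
  simp [funext_iff]

lemma vectorRank_sub_le [IsPrincipalIdealRing R] (u v : Fin n → S) :
    vectorRank R (u - v) ≤ vectorRank R u + vectorRank R v := by
  rw [vectorRank_le_iff]
  refine ((vectorRank_le_iff.1 le_rfl).sup (vectorRank_le_iff.1 le_rfl)).of_le ?_
  rw [rankSupport, Submodule.span_le]
  rintro _ ⟨i, rfl⟩
  refine Submodule.sub_mem_sup ?_ ?_ <;> exact Submodule.subset_span ⟨i, rfl⟩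

lemma eq_of_vectorRank_sub_le [IsPrincipalIdealRing R] {C : Submodule S (Fin n → S)}
    {c c' y : Fin n → S} (hc : c ∈ C) (hc' : c' ∈ C) {r : ℕ}
    (hr : r ≤ errorCorrectionCapability R C) (h : vectorRank R (y - c) ≤ r)
    (h' : vectorRank R (y - c') ≤ r) : c = c' := by
  by_contra hne
  have hd : minRankDistance R C ≤ vectorRank R (c - c') := Nat.sInf_le ⟨c, hc, c', hc', hne, rfl⟩
  have hle := vectorRank_sub_le (R := R) (y - c') (y - c)
  rw [sub_sub_sub_cancel_left] at hle
  -- Needed when the minimum distance is `0`, where `d - 1` truncates to `0`.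
  have hpos : vectorRank R (c - c') ≠ 0 := by
    rwa [Ne, vectorRank_eq_zero_iff, sub_eq_zero]
  unfold errorCorrectionCapability at hr
  omega

/-- A vector has rank at most `r` if and only if it is annihilated by a monic skew polynomial of
degree `r`. -/
lemma HasSkewFactorization.vectorRank_le_iff [IsPrincipalIdealRing R] {σ : S ≃ₐ[R] S}
    (h : HasSkewFactorization σ) {u : Fin n → S} {r : ℕ} :
    vectorRank R u ≤ r ↔ ∃ z : Fin (r + 1) → S, z (Fin.last r) = 1 ∧
      ∑ l : Fin (r + 1), z l • powApply σ l u = 0 := by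
  rw [_root_.vectorRank_le_iff]
  constructor
  · rintro ⟨b, hb⟩
    obtain ⟨z, hz, hzb⟩ := exists_skewEval_eq_zero h.exists_mul b
    have hle : rankSupport R u ≤ LinearMap.ker (skewEval σ z (r + 1)) := by
      rw [← hb, Submodule.span_le]
      rintro _ ⟨i, rfl⟩
      exact hzb i
    refine ⟨fun l => z l, hz, ?_⟩
    funext i
    have := hle (Submodule.subset_span ⟨i, rfl⟩)
    rw [LinearMap.mem_ker, skewEval_apply, ← Fin.sum_univ_eq_sum_range] at this
    simpa [powApply] using this
  · rintro ⟨z, hz, hzu⟩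
    let w : ℕ → S := fun l => if hl : l < r + 1 then z ⟨l, hl⟩ else 0
    have hw (l : Fin (r + 1)) : w l = z l := dif_pos l.isLt
    refine h.generatedBy (z := w) ((hw (Fin.last r)).trans hz) fun s hs => ?_
    have hle : rankSupport R u ≤ LinearMap.ker (skewEval σ w (r + 1)) := by
      rw [rankSupport, Submodule.span_le]
      rintro _ ⟨i, rfl⟩
      rw [SetLike.mem_coe, LinearMap.mem_ker, skewEval_apply, ← Fin.sum_univ_eq_sum_range]
      simp only [hw]
      simpa [powApply] using congrFun hzu i
    exact hle hs

lemma powApply_sub (σ : S ≃ₐ[R] S) (l : ℕ) (u v : Fin n → S) :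
    powApply σ l (u - v) = powApply σ l u - powApply σ l v := by
  funext i
  simp [powApply]

lemma HasSkewFactorization.exists_solvesKeyEquation_iff [IsPrincipalIdealRing R] {σ : S ≃ₐ[R] S}
    (h : HasSkewFactorization σ) {k : ℕ} (G : Matrix (Fin k) (Fin n) S) (y : Fin n → S) (r : ℕ)
    (x : Fin k → S) :
    (∃ z : Fin (r + 1) → S, SolvesKeyEquation σ G y z x) ↔
      vectorRank R (y - Matrix.vecMul x G) ≤ r := by
  rw [h.vectorRank_le_iff]
  simp only [SolvesKeyEquation, powApply_sub, smul_sub, Finset.sum_sub_distrib, sub_eq_zero]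

lemma IsGeneratorMatrix.mem_iff {k : ℕ} {G : Matrix (Fin k) (Fin n) S}
    {C : Submodule S (Fin n → S)} (hG : IsGeneratorMatrix G C) {c : Fin n → S} :
    c ∈ C ↔ ∃ x, Matrix.vecMul x G = c := by
  rw [← hG, Submodule.mem_span_range_iff_exists_fun]
  simp only [Matrix.vecMul_eq_sum]
  rfl

/-- Identifying `C` with `S^k` turns `x ↦ xG` into a surjective endomorphism of a finite module,
which is injective. -/
lemma IsGeneratorMatrix.vecMul_injective [Nontrivial S] {k : ℕ} {G : Matrix (Fin k) (Fin n) S}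
    {C : Submodule S (Fin n → S)} (hG : IsGeneratorMatrix G C) [Module.Free S C]
    (hk : Module.finrank S C = k) : Function.Injective fun x => Matrix.vecMul x G := by
  have hrange : LinearMap.range G.vecMulLinear = C := by
    ext c
    rw [LinearMap.mem_range, hG.mem_iff]
    rfl
  have : Module.Finite S C := by
    rw [← hrange]
    infer_instance
  let f : (Fin k → S) →ₗ[S] C := G.vecMulLinear.codRestrict C fun x => hG.mem_iff.2 ⟨x, rfl⟩
  have hf : Function.Surjective f := by
    rintro ⟨c, hc⟩
    obtain ⟨x, rfl⟩ := hG.mem_iff.1 hc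
    exact ⟨x, rfl⟩
  let e : C ≃ₗ[S] (Fin k → S) := LinearEquiv.ofFinrankEq _ _ (by simp [hk])
  have hinj := OrzechProperty.injective_of_surjective_endomorphism (e.toLinearMap ∘ₗ f)
    (e.surjective.comp hf)
  intro x x' hxx
  apply hinj
  simp only [LinearMap.comp_apply]
  congr 1
  exact Subtype.ext hxx

end RankMetric

theorem theorem5p2 {R : Type u} {S : Type v} [CommRing R] [Finite R] [IsPrincipalIdealRing R]
    [CommRing S] [Algebra R S] {m : ℕ} {σ : S ≃ₐ[R] S} (hσ : IsGaloisExtension R S m σ)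
    {k n : ℕ} (C : Submodule S (Fin n → S)) (G : Matrix (Fin k) (Fin n) S)
    (hG : IsGeneratorMatrix G C) (y : Fin n → S) (r : ℕ) :
    ((∃ c ∈ C, vectorRank R (y - c) ≤ r) ↔
      ∃ (z : Fin (r + 1) → S) (x : Fin k → S), SolvesKeyEquation σ G y z x) ∧
    (Module.Free S C → Module.finrank S C = k → r ≤ errorCorrectionCapability R C →
      ∀ (z z' : Fin (r + 1) → S) (x x' : Fin k → S),
        SolvesKeyEquation σ G y z x → SolvesKeyEquation σ G y z' x' → x = x') := by
  have h := hσ.hasSkewFactorization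
  constructor
  · rw [exists_comm]
    simp only [h.exists_solvesKeyEquation_iff]
    constructor
    · rintro ⟨c, hc, hr⟩
      obtain ⟨x, rfl⟩ := hG.mem_iff.1 hc
      exact ⟨x, hr⟩
    · rintro ⟨x, hr⟩
      exact ⟨_, hG.mem_iff.2 ⟨x, rfl⟩, hr⟩
  · intro _ hk hr z z' x x' hz hz'
    nontriviality S
    exact hG.vecMul_injective hk (eq_of_vectorRank_sub_le (hG.mem_iff.2 ⟨x, rfl⟩)
      (hG.mem_iff.2 ⟨x', rfl⟩) hr ((h.exists_solvesKeyEquation_iff G y r x).1 ⟨z, hz⟩)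
      ((h.exists_solvesKeyEquation_iff G y r x').1 ⟨z', hz'⟩))
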